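/- Let $G$ be a diffeological group, let $H$ be an arbitrary subgroup of $G$ (not necessarily closed), equip the set of cosets $G/H$ with the quotient diffeology, and let $X$ be a diffeological space diffeomorphic to $G/H$ (a homogeneous space). Let $TX=\coprod_{x\in X}T_x(X)$ be the internal tangent bundle of $X$, where the internal tangent space $T_x(X)$ is the colimit of the vector spaces $T_0(U)$ over the category of pointed plots $p:(U,0)\to(X,x)$, with $U$ a connected open neighbourhood of $0$ in some $\mathbb{R}^n$; its morphisms from $p:(U,0)\to(X,x)$ to $q:(V,0)\to(X,x)$ are the smooth maps $f:U\to V$ with $f(0)=0$ and $q\circ f=p$. Write * $T^H X$ for $TX$ with Hector's diffeology, that is, the smallest diffeology on $TX$ for which the maps $Tr:TU=U\times\mathbb{R}^n\to TX$ induced by all plots $r:U\to X$, with $U\subseteq\mathbb{R}^n$ open and connected, $n \in \mathbb{N}$, are smooth; * $T^{dvs} X$ for $TX$ with the smallest diffeology that contains Hector's diffeology and makes $TX$ a diffeological vector space over $X$, that is, for which the projection $TX\to X$, the fibrewise addition $TX\times_X TX\to TX$, the scalar multiplication $\mathbb{R}\times TX\to TX$ and the zero section $X\to TX$ are smooth.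 Then $T^H X=T^{dvs}X$, that is, the two diffeologies on $TX$ coincide. -/

import Mathlib

open scoped ContDiff
open Diffeology

noncomputable section

/-! ### Plots on open subsets, and basic constructions of diffeologies

Mathlib records a diffeology through its plots `ℝⁿ → X`. For an open set `u ⊆ ℝⁿ`, a map `u → X` is
represented by a function `p : ℝⁿ → X` whose values off `u` are irrelevant. -/

/-- The restriction of `p` to the open set `u` is a plot `u → X`: its composite with every smooth map
`ℝᵐ → u` is a plot. -/
def IsPlotOn {X : Type*} [DiffeologicalSpace X] {n : ℕ}
    (u : Set (EuclideanSpace ℝ (Fin n))) (p : EuclideanSpace ℝ (Fin n) → X) : Prop :=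
  ∀ (m : ℕ) (f : EuclideanSpace ℝ (Fin m) → EuclideanSpace ℝ (Fin n)),
    ContDiff ℝ ∞ f → (∀ s, f s ∈ u) → IsPlot (p ∘ f)

theorem IsPlotOn.reparam {X : Type*} [DiffeologicalSpace X] {n m : ℕ}
    {u : Set (EuclideanSpace ℝ (Fin n))} {v : Set (EuclideanSpace ℝ (Fin m))}
    {p : EuclideanSpace ℝ (Fin n) → X}
    {f : EuclideanSpace ℝ (Fin m) → EuclideanSpace ℝ (Fin n)}
    (hp : IsPlotOn u p) (hf : ContDiffOn ℝ ∞ f v) (h : Set.MapsTo f v u) :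
    IsPlotOn v (p ∘ f) :=
  fun k g hg hgv ↦ hp k (f ∘ g) (hf.comp_contDiff hg hgv) fun s ↦ h (hgv s)

/-- The pullback of a diffeology along a function (for an injection: the sub-diffeology). -/
@[reducible]
def inducedDiffeology {X Y : Type*} (f : X → Y) (d : DiffeologicalSpace Y) :
    DiffeologicalSpace X where
  plots _ := {p | IsPlot (f ∘ p)}
  constant_plots _ := isPlot_const
  plot_reparam {_ _ p _} hp hf := isPlot_reparam (p := f ∘ p) hp hf
  locality hp := DiffeologicalSpace.locality hp

/-- The product diffeology. -/
instance prodDiffeology {X Y : Type*} [dX : DiffeologicalSpace X] [dY : DiffeologicalSpace Y] :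
    DiffeologicalSpace (X × Y) :=
  inducedDiffeology Prod.fst dX ⊓ inducedDiffeology Prod.snd dY

/-- The quotient diffeology along a surjection `π : X → Y`: its plots are the functions that locally
factor through `π` via plots of `X`. -/
@[reducible]
def quotientDiffeology {X Y : Type*} [DiffeologicalSpace X] (π : X → Y)
    (hπ : Function.Surjective π) : DiffeologicalSpace Y :=
  .ofCorePlotsOn {
    isPlotOn := fun {n u} _ p ↦ ∀ x ∈ u, ∃ v : Set (EuclideanSpace ℝ (Fin n)),
      IsOpen v ∧ x ∈ v ∧ v ⊆ u ∧
        ∃ q : EuclideanSpace ℝ (Fin n) → X, IsPlotOn v q ∧ ∀ y ∈ v, π (q y) = p y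
    isPlotOn_congr := fun {n u} hu p q h ↦ by
      constructor
      · intro H x hx
        obtain ⟨v, hv, hxv, hvu, r, hr, hrp⟩ := H x hx
        exact ⟨v, hv, hxv, hvu, r, hr, fun y hy ↦ (hrp y hy).trans (h (hvu hy))⟩
      · intro H x hx
        obtain ⟨v, hv, hxv, hvu, r, hr, hrp⟩ := H x hx
        exact ⟨v, hv, hxv, hvu, r, hr, fun y hy ↦ (hrp y hy).trans (h (hvu hy)).symm⟩
    isPlot_const := fun {n} y x _ ↦ by
      obtain ⟨z, hz⟩ := hπ y
      exact ⟨Set.univ, isOpen_univ, trivial, subset_rfl, fun _ ↦ z,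
        fun _ _ _ _ ↦ isPlot_const, fun _ _ ↦ hz⟩
    isPlotOn_reparam := fun {n m u v hu} hv {p f} h hp hf x hx ↦ by
      obtain ⟨w, hw, hxw, hwu, q, hq, hqp⟩ := hp (f x) (h hx)
      exact ⟨v ∩ f ⁻¹' w, hf.continuousOn.isOpen_inter_preimage hv hw, ⟨hx, hxw⟩,
        Set.inter_subset_left, q ∘ f,
        hq.reparam (hf.mono Set.inter_subset_left) fun y hy ↦ hy.2, fun y hy ↦ hqp (f y) hy.2⟩
    locality := fun {n u} hu {p} H x hx ↦ by
      obtain ⟨v, hv, hxv, Hv⟩ := H x hx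
      obtain ⟨w, hw, hxw, hwv, q, hq, hqp⟩ := Hv x hxv
      exact ⟨w ∩ u, hw.inter hu, ⟨hxw, hx⟩, Set.inter_subset_right, q,
        fun k g hg hgu ↦ hq k g hg fun s ↦ (hgu s).1, fun y hy ↦ hqp y hy.1⟩ }

/-! ### Diffeological groups and their homogeneous spaces -/

/-- A diffeological group: a group with a diffeology for which multiplication and inversion are
smooth. -/
class IsDiffeologicalGroup (G : Type*) [Group G] [DiffeologicalSpace G] : Prop where
  smooth_mul : DSmooth fun p : G × G ↦ p.1 * p.2
  smooth_inv : DSmooth fun g : G ↦ g⁻¹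

/-- The set of cosets `G ⧸ H` carries the quotient diffeology. -/
instance cosetDiffeology {G : Type*} [Group G] [DiffeologicalSpace G] (H : Subgroup G) :
    DiffeologicalSpace (G ⧸ H) :=
  quotientDiffeology (QuotientGroup.mk : G → G ⧸ H) QuotientGroup.mk_surjective

/-! ### The internal tangent space -/

/-- The plots of `X` centered at `x`: plots `p : (U, 0) → (X, x)` with `U` a connected open
neighbourhood of `0` in some `ℝⁿ`. -/
structure CenteredPlot {X : Type*} [DiffeologicalSpace X] (x : X) where
  dim : ℕ
  dom : Set (EuclideanSpace ℝ (Fin dim))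
  isOpen_dom : IsOpen dom
  isConnected_dom : IsConnected dom
  zero_mem : (0 : EuclideanSpace ℝ (Fin dim)) ∈ dom
  toFun : EuclideanSpace ℝ (Fin dim) → X
  isPlotOn : IsPlotOn dom toFun
  map_zero : toFun 0 = x

/-- `f` is a morphism `p ⟶ q` of centered plots: a smooth map between the domains with `f 0 = 0` and
`q ∘ f = p`. (Two centered plots with the same restriction to the same domain are isomorphic through
the identity, so values off the domain play no role.) -/
structure CenteredPlot.IsHom {X : Type*} [DiffeologicalSpace X] {x : X} (p q : CenteredPlot x)
    (f : EuclideanSpace ℝ (Fin p.dim) → EuclideanSpace ℝ (Fin q.dim)) : Prop where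
  contDiffOn : ContDiffOn ℝ ∞ f p.dom
  mapsTo : Set.MapsTo f p.dom q.dom
  map_zero : f 0 = 0
  comm : Set.EqOn (q.toFun ∘ f) p.toFun p.dom

open Classical in
/-- The relations `(p, v) ∼ (q, f_* v)`, one for each morphism `f : p ⟶ q` of centered plots and each
`v ∈ T₀(U_p) = ℝⁿ`. -/
def tangentRelations {X : Type*} [DiffeologicalSpace X] (x : X) :
    Submodule ℝ (DirectSum (CenteredPlot x) fun p ↦ EuclideanSpace ℝ (Fin p.dim)) :=
  Submodule.span ℝ {w | ∃ (p q : CenteredPlot x)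
    (f : EuclideanSpace ℝ (Fin p.dim) → EuclideanSpace ℝ (Fin q.dim))
    (v : EuclideanSpace ℝ (Fin p.dim)), p.IsHom q f ∧
    w = DirectSum.lof ℝ (CenteredPlot x) (fun p ↦ EuclideanSpace ℝ (Fin p.dim)) p v
      - DirectSum.lof ℝ (CenteredPlot x) (fun p ↦ EuclideanSpace ℝ (Fin p.dim)) q
          (fderiv ℝ f 0 v)}

/-- The internal tangent space `T_x(X)`: the colimit of the tangent spaces `T₀(U)` over the category
of plots `(U, 0) → (X, x)` centered at `x`, as the direct sum modulo the relations imposed by the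
morphisms. -/
def InternalTangentSpace {X : Type*} [DiffeologicalSpace X] (x : X) : Type _ :=
  (DirectSum (CenteredPlot x) fun p ↦ EuclideanSpace ℝ (Fin p.dim)) ⧸ tangentRelations x

instance {X : Type*} [DiffeologicalSpace X] (x : X) : AddCommGroup (InternalTangentSpace x) :=
  inferInstanceAs (AddCommGroup (_ ⧸ tangentRelations x))

instance {X : Type*} [DiffeologicalSpace X] (x : X) : Module ℝ (InternalTangentSpace x) :=
  inferInstanceAs (Module ℝ (_ ⧸ tangentRelations x))

open Classical in
/-- The element `p_*(v)` of `T_x(X)` represented by a centered plot `p : (U, 0) → (X, x)` and a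
vector `v ∈ T₀(U)`. -/
def CenteredPlot.push {X : Type*} [DiffeologicalSpace X] {x : X} (p : CenteredPlot x)
    (v : EuclideanSpace ℝ (Fin p.dim)) : InternalTangentSpace x :=
  (tangentRelations x).mkQ
    (DirectSum.lof ℝ (CenteredPlot x) (fun p ↦ EuclideanSpace ℝ (Fin p.dim)) p v)

/-! ### The internal tangent bundle with Hector's diffeology -/

/-- The underlying set of the internal tangent bundle: the disjoint union of the `T_x(X)`. -/
abbrev InternalTangentBundle (X : Type*) [DiffeologicalSpace X] : Type _ :=
  Σ x : X, InternalTangentSpace x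

/-- A plot `r : U → X` with `U` open and connected in `ℝⁿ`, recentered at `a ∈ U`: this is
`y ↦ r (a + y)` on `U - a`. -/
def recenter {X : Type*} [DiffeologicalSpace X] {n : ℕ}
    {U : Set (EuclideanSpace ℝ (Fin n))} (hU : IsOpen U) (hc : IsConnected U)
    {r : EuclideanSpace ℝ (Fin n) → X} (hr : IsPlotOn U r)
    {a : EuclideanSpace ℝ (Fin n)} (ha : a ∈ U) : CenteredPlot (r a) where
  dim := n
  dom := (fun y ↦ a + y) ⁻¹' U
  isOpen_dom := hU.preimage (by fun_prop)
  isConnected_dom := by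
    have h : (fun y ↦ a + y) ⁻¹' U = (fun y ↦ -a + y) '' U := by
      ext y
      constructor
      · intro hy
        exact ⟨a + y, hy, by simp⟩
      · rintro ⟨z, hz, rfl⟩
        simpa using hz
    rw [h]
    exact hc.image _ (by fun_prop)
  zero_mem := by simpa using ha
  toFun := fun y ↦ r (a + y)
  isPlotOn := hr.reparam (f := fun y ↦ a + y) (by fun_prop) fun _ hy ↦ hy
  map_zero := by simp

/-- The map `T r : TU = U × ℝⁿ → TX` induced by a plot `r : U → X`. -/
def plotTangentMap {X : Type*} [DiffeologicalSpace X] {n : ℕ}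
    {U : Set (EuclideanSpace ℝ (Fin n))} (hU : IsOpen U) (hc : IsConnected U)
    {r : EuclideanSpace ℝ (Fin n) → X} (hr : IsPlotOn U r)
    (a : U) (v : EuclideanSpace ℝ (Fin n)) : InternalTangentBundle X :=
  ⟨r a, (recenter hU hc hr a.2).push v⟩

/-- Hector's diffeology on `TX`, which makes it `T^H X`: the diffeology generated by the maps
`T r : TU → TX`, for all plots `r : U → X` with `U` open and connected, i.e. the smallest diffeology
containing all `T r ∘ (a, v)` with `(a, v) : ℝᵐ → U × ℝⁿ` smooth. -/
@[reducible]
def hectorDiffeology (X : Type*) [DiffeologicalSpace X] :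
    DiffeologicalSpace (InternalTangentBundle X) :=
  .generateFrom {P | ∃ (m n : ℕ) (U : Set (EuclideanSpace ℝ (Fin n))) (hU : IsOpen U)
    (hc : IsConnected U) (r : EuclideanSpace ℝ (Fin n) → X) (hr : IsPlotOn U r)
    (a : EuclideanSpace ℝ (Fin m) → U)
    (v : EuclideanSpace ℝ (Fin m) → EuclideanSpace ℝ (Fin n)),
    ContDiff ℝ ∞ (fun s ↦ (a s : EuclideanSpace ℝ (Fin n))) ∧ ContDiff ℝ ∞ v ∧
    P = ⟨m, fun s ↦ plotTangentMap hU hc hr (a s) (v s)⟩}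

/-! ### Diffeological vector spaces over `X` and the dvs diffeology -/

/-- The fibre product `V ×_X V` of the total space `V = Σ x, E x` with itself. -/
def FiberSquare {X : Type*} (E : X → Type*) : Type _ := Σ x, E x × E x

/-- `V ×_X V` carries the sub-diffeology of the product diffeology on `V × V`. -/
instance {X : Type*} (E : X → Type*) [DiffeologicalSpace (Σ x, E x)] :
    DiffeologicalSpace (FiberSquare E) :=
  inducedDiffeology
    (fun w : FiberSquare E ↦ ((⟨w.1, w.2.1⟩, ⟨w.1, w.2.2⟩) : (Σ x, E x) × (Σ x, E x)))
    prodDiffeology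

/-- The diffeology `d` makes `V = Σ x, E x → X` into a diffeological vector space over `X`: the
projection `V → X`, the addition `V ×_X V → V`, the scalar multiplication `ℝ × V → V` and the zero
section `X → V` are smooth. -/
structure IsDVSOver {X : Type*} [DiffeologicalSpace X] (E : X → Type*)
    [∀ x, AddCommGroup (E x)] [∀ x, Module ℝ (E x)] (d : DiffeologicalSpace (Σ x, E x)) :
    Prop where
  smooth_proj : DSmooth fun w : Σ x, E x ↦ w.1
  smooth_add : DSmooth fun w : FiberSquare E ↦ (⟨w.1, w.2.1 + w.2.2⟩ : Σ x, E x)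
  smooth_smul : DSmooth fun w : ℝ × (Σ x, E x) ↦ (⟨w.2.1, w.1 • w.2.2⟩ : Σ x, E x)
  smooth_zero : DSmooth fun x : X ↦ (⟨x, 0⟩ : Σ x, E x)

/-- The dvs diffeology on `TX`, which makes it `T^{dvs} X`: the smallest diffeology that contains
Hector's diffeology and makes `TX` into a diffeological vector space over `X`. -/
@[reducible]
def dvsDiffeology (X : Type*) [DiffeologicalSpace X] :
    DiffeologicalSpace (InternalTangentBundle X) :=
  sInf {d | hectorDiffeology X ≤ d ∧ IsDVSOver (fun x : X ↦ InternalTangentSpace x) d}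

/-- The smallest diffeology in the definition of `dvsDiffeology` exists. -/
theorem isLeast_dvsDiffeology (X : Type*) [dX : DiffeologicalSpace X] :
    IsLeast {d | hectorDiffeology X ≤ d ∧ IsDVSOver (fun x : X ↦ InternalTangentSpace x) d}
      (dvsDiffeology X) := by
  -- the diffeology of all functions with smooth projection lies in the set
  have key : hectorDiffeology X ≤ inducedDiffeology Sigma.fst dX ∧
      IsDVSOver (fun x : X ↦ InternalTangentSpace x) (inducedDiffeology Sigma.fst dX) := by
    refine ⟨?_, ?_, ?_, ?_, ?_⟩
    · refine DiffeologicalSpace.generateFrom_le_iff.2 ?_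
      rintro k p ⟨m, n, U, hU, hc, r, hr, a, v, ha, hv, hP⟩
      obtain ⟨rfl, hP⟩ := Sigma.mk.inj hP
      cases hP
      exact hr k (fun s ↦ (a s : EuclideanSpace ℝ (Fin n))) ha fun s ↦ (a s).2
    · exact fun n p hp ↦ hp
    · intro n p hp
      exact hp.1
    · intro n p hp
      exact hp.2
    · intro n p hp
      exact hp
  refine ⟨⟨le_sInf fun d hd ↦ hd.1, ?_, ?_, ?_, ?_⟩, fun d hd ↦ sInf_le hd⟩
  · intro n p hp
    exact (DiffeologicalSpace.isPlot_sInf_iff.1 hp) _ key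
  · intro n p hp
    refine DiffeologicalSpace.isPlot_sInf_iff.2 fun d hd ↦ hd.2.smooth_add n p ⟨?_, ?_⟩
    · exact DiffeologicalSpace.isPlot_sInf_iff.1 hp.1 d hd
    · exact DiffeologicalSpace.isPlot_sInf_iff.1 hp.2 d hd
  · intro n p hp
    exact DiffeologicalSpace.isPlot_sInf_iff.2 fun d hd ↦ hd.2.smooth_smul n p
      ⟨hp.1, DiffeologicalSpace.isPlot_sInf_iff.1 hp.2 d hd⟩
  · intro n p hp
    exact DiffeologicalSpace.isPlot_sInf_iff.2 fun d hd ↦ hd.2.smooth_zero n p hp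

end

open Topology

noncomputable section

/-! ### Linearity and naturality of `CenteredPlot.push` -/

section Push

variable {X : Type*} [DiffeologicalSpace X] {x : X}

/-! Hector's diffeology is contained in the dvs diffeology, so it suffices that it already makes
`TX` a diffeological vector space over `X`. Only fibrewise addition is problematic: two plots of
`TX` over the same base map may come from unrelated plots `r₁`, `r₂` of `X`, and adding the vectors
requires one plot through which both factor.

The group supplies it. Lift `r₁`, `r₂` locally to `g₁`, `g₂` in `G`, let `a₁ s`, `a₂ s` be the two
base parameters, and set `F (s, y₁, y₂) = q (g₁ (a₁ s + y₁) * (g₁ (a₁ s))⁻¹ * g₂ (a₂ s + y₂))`. For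
`y₁ = 0` this is `r₂ (a₂ s + y₂)`. For `y₂ = 0` it is `r₁ (a₁ s + y₁)`, because `g₁ (a₁ s)` and `g₂
(a₂ s)` lie over the same point and left translation preserves the fibres of `q`. Both tangent
vectors thus live in one tangent space of the domain of `F`, depend smoothly on `s`, and can be
added there (`isTangentPlotAt_add`).

To conclude, plots of Hector's diffeology must be known to factor locally through some `T r`. This
is not automatic for constant plots, since a tangent vector is a priori only a sum of pushforwards;
the same addition argument settles it (`isTangentPlotAt_const`, `isPlot_hectorDiffeology_iff`). -/

theorem CenteredPlot.push_add (p : CenteredPlot x) (v w : EuclideanSpace ℝ (Fin p.dim)) :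
    p.push (v + w) = p.push v + p.push w := by
  unfold CenteredPlot.push
  rw [map_add, map_add]
  rfl

theorem CenteredPlot.push_smul (p : CenteredPlot x) (c : ℝ) (v : EuclideanSpace ℝ (Fin p.dim)) :
    p.push (c • v) = c • p.push v := by
  unfold CenteredPlot.push
  rw [map_smul, map_smul]
  rfl

theorem CenteredPlot.push_zero (p : CenteredPlot x) : p.push 0 = 0 := by
  simpa using p.push_smul 0 0

theorem CenteredPlot.IsHom.push_eq {p q : CenteredPlot x}
    {f : EuclideanSpace ℝ (Fin p.dim) → EuclideanSpace ℝ (Fin q.dim)} (hf : p.IsHom q f)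
    (v : EuclideanSpace ℝ (Fin p.dim)) : p.push v = q.push (fderiv ℝ f 0 v) :=
  (Submodule.Quotient.eq _).2 (Submodule.subset_span ⟨p, q, f, v, hf, rfl⟩)

/-- The restriction of a centered plot to a ball around the origin. -/
def CenteredPlot.restrictBall (p : CenteredPlot x) {ε : ℝ} (hε : 0 < ε)
    (h : Metric.ball 0 ε ⊆ p.dom) : CenteredPlot x where
  dim := p.dim
  dom := Metric.ball 0 ε
  isOpen_dom := Metric.isOpen_ball
  isConnected_dom := Metric.isConnected_ball hε
  zero_mem := Metric.mem_ball_self hε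
  toFun := p.toFun
  isPlotOn := fun m f hf hu ↦ p.isPlotOn m f hf fun s ↦ h (hu s)
  map_zero := p.map_zero

/-- The class `p_* v` only depends on the germ of `p` at the origin, and is natural under linear
maps. -/
theorem CenteredPlot.push_eq_of_eventuallyEq {p q : CenteredPlot x}
    (L : EuclideanSpace ℝ (Fin p.dim) →L[ℝ] EuclideanSpace ℝ (Fin q.dim))
    (h : ∀ᶠ y in 𝓝 0, q.toFun (L y) = p.toFun y) (v : EuclideanSpace ℝ (Fin p.dim)) :
    p.push v = q.push (L v) := by
  have hq : ∀ᶠ y in 𝓝 0, L y ∈ q.dom := by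
    refine L.continuous.continuousAt.eventually_mem ?_
    rw [L.map_zero]
    exact q.isOpen_dom.mem_nhds q.zero_mem
  have hp : ∀ᶠ y in 𝓝 0, y ∈ p.dom := p.isOpen_dom.mem_nhds p.zero_mem
  obtain ⟨ε, hε, H⟩ := Metric.eventually_nhds_iff_ball.1 (hp.and (hq.and h))
  -- The restriction to a small ball maps to `p` by inclusion and to `q` by `L`; the two morphisms
  -- identify the classes.
  let p' := p.restrictBall hε fun y hy ↦ (H y hy).1
  have h₁ : p'.IsHom p fun y ↦ y :=
    ⟨contDiffOn_id, fun y hy ↦ (H y hy).1, rfl, fun _ _ ↦ rfl⟩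
  have h₂ : p'.IsHom q L :=
    ⟨L.contDiff.contDiffOn, fun y hy ↦ (H y hy).2.1, L.map_zero, fun y hy ↦ (H y hy).2.2⟩
  have e₁ := h₁.push_eq v
  have e₂ := h₂.push_eq v
  have d₁ : fderiv ℝ (fun y : EuclideanSpace ℝ (Fin p.dim) ↦ y) 0 v = v := by simp
  have d₂ : fderiv ℝ L 0 v = L v := by rw [L.fderiv]
  exact (congrArg p.push d₁).symm.trans (e₁.symm.trans (e₂.trans (congrArg q.push d₂)))

/-- Working in the total space avoids transport between tangent spaces: the base points agree
because the germs agree at the origin. -/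
theorem CenteredPlot.mk_push_eq {x y : X} {p : CenteredPlot x} {q : CenteredPlot y}
    (L : EuclideanSpace ℝ (Fin p.dim) →L[ℝ] EuclideanSpace ℝ (Fin q.dim))
    (h : ∀ᶠ y in 𝓝 0, q.toFun (L y) = p.toFun y) (v : EuclideanSpace ℝ (Fin p.dim)) :
    (⟨x, p.push v⟩ : InternalTangentBundle X) = ⟨y, q.push (L v)⟩ := by
  have hxy : x = y := by
    rw [← p.map_zero, ← q.map_zero, ← h.self_of_nhds, L.map_zero]
  subst hxy
  rw [CenteredPlot.push_eq_of_eventuallyEq L h]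

theorem plotTangentMap_eq_of_eventuallyEq {n k : ℕ}
    {U : Set (EuclideanSpace ℝ (Fin n))} {hU : IsOpen U} {hc : IsConnected U}
    {r : EuclideanSpace ℝ (Fin n) → X} {hr : IsPlotOn U r}
    {W : Set (EuclideanSpace ℝ (Fin k))} {hW : IsOpen W} {hWc : IsConnected W}
    {R : EuclideanSpace ℝ (Fin k) → X} {hR : IsPlotOn W R} {a : U} {A : W}
    (L : EuclideanSpace ℝ (Fin n) →L[ℝ] EuclideanSpace ℝ (Fin k))
    (h : ∀ᶠ y in 𝓝 0, R (A + L y) = r (a + y)) (v : EuclideanSpace ℝ (Fin n)) :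
    plotTangentMap hU hc hr a v = plotTangentMap hW hWc hR A (L v) :=
  CenteredPlot.mk_push_eq (p := recenter hU hc hr a.2) (q := recenter hW hWc hR A.2) L h v

theorem CenteredPlot.mk_push_eq_plotTangentMap (p : CenteredPlot x)
    (v : EuclideanSpace ℝ (Fin p.dim)) :
    (⟨x, p.push v⟩ : InternalTangentBundle X) =
      plotTangentMap p.isOpen_dom p.isConnected_dom p.isPlotOn ⟨0, p.zero_mem⟩ v :=
  CenteredPlot.mk_push_eq (p := p)
    (q := recenter p.isOpen_dom p.isConnected_dom p.isPlotOn p.zero_mem)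
    (ContinuousLinearMap.id ℝ _)
    (Filter.Eventually.of_forall fun y ↦ congrArg p.toFun (zero_add y)) v

end Push

/-! ### Functions that locally factor through the maps `T r` -/

/-- Near `s₀`, the function `P : ℝᵐ → TX` is of the form `T r ∘ (a, v)` for a plot `r : U → X` and
smooth functions `a`, `v`. -/
def IsTangentPlotAt {X : Type*} [DiffeologicalSpace X] {m : ℕ}
    (P : EuclideanSpace ℝ (Fin m) → InternalTangentBundle X) (s₀ : EuclideanSpace ℝ (Fin m)) :
    Prop :=
  ∃ N : Set (EuclideanSpace ℝ (Fin m)), IsOpen N ∧ s₀ ∈ N ∧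
    ∃ (n : ℕ) (U : Set (EuclideanSpace ℝ (Fin n))) (hU : IsOpen U) (hc : IsConnected U)
      (r : EuclideanSpace ℝ (Fin n) → X) (hr : IsPlotOn U r)
      (a v : EuclideanSpace ℝ (Fin m) → EuclideanSpace ℝ (Fin n)),
      ContDiffOn ℝ ∞ a N ∧ ContDiffOn ℝ ∞ v N ∧
      ∀ s ∈ N, ∃ h : a s ∈ U, P s = plotTangentMap hU hc hr ⟨a s, h⟩ (v s)

namespace IsTangentPlotAt

variable {X : Type*} [DiffeologicalSpace X] {m : ℕ}
  {P Q : EuclideanSpace ℝ (Fin m) → InternalTangentBundle X} {s₀ : EuclideanSpace ℝ (Fin m)}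

theorem congr (hP : IsTangentPlotAt P s₀) {u : Set (EuclideanSpace ℝ (Fin m))} (hu : IsOpen u)
    (hs : s₀ ∈ u) (h : Set.EqOn P Q u) : IsTangentPlotAt Q s₀ := by
  obtain ⟨N, hN, hsN, n, U, hU, hc, r, hr, a, v, ha, hv, H⟩ := hP
  exact ⟨N ∩ u, hN.inter hu, ⟨hsN, hs⟩, n, U, hU, hc, r, hr, a, v, ha.mono Set.inter_subset_left,
    hv.mono Set.inter_subset_left, fun s hs ↦ h hs.2 ▸ H s hs.1⟩

theorem comp {k : ℕ} {u : Set (EuclideanSpace ℝ (Fin k))} (hu : IsOpen u)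
    {f : EuclideanSpace ℝ (Fin k) → EuclideanSpace ℝ (Fin m)} (hf : ContDiffOn ℝ ∞ f u)
    {t₀ : EuclideanSpace ℝ (Fin k)} (ht : t₀ ∈ u) (hP : IsTangentPlotAt P (f t₀)) :
    IsTangentPlotAt (P ∘ f) t₀ := by
  obtain ⟨N, hN, hsN, n, U, hU, hc, r, hr, a, v, ha, hv, H⟩ := hP
  have hf' := hf.mono (Set.inter_subset_left (t := f ⁻¹' N))
  exact ⟨u ∩ f ⁻¹' N, hf.continuousOn.isOpen_inter_preimage hu hN, ⟨ht, hsN⟩, n, U, hU, hc, r, hr,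
    a ∘ f, v ∘ f, ha.comp hf' fun t ht ↦ ht.2, hv.comp hf' fun t ht ↦ ht.2,
    fun t ht ↦ H (f t) ht.2⟩

theorem smul {c : EuclideanSpace ℝ (Fin m) → ℝ} (hc : ContDiff ℝ ∞ c)
    (hP : IsTangentPlotAt P s₀) :
    IsTangentPlotAt (fun s ↦ (⟨(P s).1, c s • (P s).2⟩ : InternalTangentBundle X)) s₀ := by
  obtain ⟨N, hN, hsN, n, U, hU, hUc, r, hr, a, v, ha, hv, H⟩ := hP
  refine ⟨N, hN, hsN, n, U, hU, hUc, r, hr, a, fun s ↦ c s • v s, ha, hc.contDiffOn.smul hv,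
    fun s hs ↦ ?_⟩
  obtain ⟨h, hs⟩ := H s hs
  refine ⟨h, ?_⟩
  change (⟨(P s).1, c s • (P s).2⟩ : InternalTangentBundle X) = _
  rw [hs]
  exact congrArg (Sigma.mk _) ((recenter hU hUc hr h).push_smul _ _).symm

/-- The base map serves as its own plot `r`, with `a` the identity and `v = 0`. -/
theorem zero {x : EuclideanSpace ℝ (Fin m) → X} (hx : IsPlot x) :
    IsTangentPlotAt (fun s ↦ (⟨x s, 0⟩ : InternalTangentBundle X)) s₀ := by
  have hx' : IsPlotOn Set.univ x := fun k f hf _ ↦ isPlot_reparam hx hf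
  refine ⟨Set.univ, isOpen_univ, trivial, m, Set.univ, isOpen_univ, isConnected_univ, x, hx',
    fun s ↦ s, fun _ ↦ 0, contDiffOn_id, contDiffOn_const, fun s _ ↦ ⟨trivial, ?_⟩⟩
  exact congrArg (Sigma.mk _)
    (recenter isOpen_univ isConnected_univ hx' (Set.mem_univ s)).push_zero.symm

theorem mk_push {x : X} (p : CenteredPlot x) (v : EuclideanSpace ℝ (Fin p.dim)) :
    IsTangentPlotAt (fun _ : EuclideanSpace ℝ (Fin m) ↦
      (⟨x, p.push v⟩ : InternalTangentBundle X)) s₀ :=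
  ⟨Set.univ, isOpen_univ, trivial, p.dim, p.dom, p.isOpen_dom, p.isConnected_dom, p.toFun,
    p.isPlotOn, fun _ ↦ 0, fun _ ↦ v, contDiffOn_const, contDiffOn_const,
    fun _ _ ↦ ⟨p.zero_mem, p.mk_push_eq_plotTangentMap v⟩⟩

/-- A function that locally factors through the maps `T r` is a plot of Hector's diffeology. -/
theorem isPlot (hP : ∀ s, IsTangentPlotAt P s) : @IsPlot _ (hectorDiffeology X) m P := by
  refine (hectorDiffeology X).locality fun s ↦ ?_
  obtain ⟨N, hN, hsN, n, U, hU, hc, r, hr, a, v, ha, hv, H⟩ := hP s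
  have ha' : ∀ s ∈ N, a s ∈ U := fun s hs ↦ (H s hs).1
  refine ⟨N, hN, hsN, fun {k f} hfN hf ↦ ?_⟩
  have hPf : P ∘ f = fun t ↦ plotTangentMap hU hc hr ⟨a (f t), ha' (f t) (hfN t)⟩ (v (f t)) :=
    funext fun t ↦ (H (f t) (hfN t)).2
  rw [hPf]
  exact DiffeologicalSpace.isPlot_generatedFrom_of_mem
    ⟨k, n, U, hU, hc, r, hr, fun t ↦ ⟨a (f t), ha' (f t) (hfN t)⟩, fun t ↦ v (f t),
      ha.comp_contDiff hf hfN, hv.comp_contDiff hf hfN, rfl⟩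

end IsTangentPlotAt

/-- If constant functions locally factor through the maps `T r`, then the functions with this
property are exactly the plots of Hector's diffeology. -/
theorem isPlot_hectorDiffeology_iff {X : Type*} [DiffeologicalSpace X]
    (hconst : ∀ (n : ℕ) (w : InternalTangentBundle X) (s : EuclideanSpace ℝ (Fin n)),
      IsTangentPlotAt (fun _ ↦ w) s)
    {m : ℕ} {P : EuclideanSpace ℝ (Fin m) → InternalTangentBundle X} :
    @IsPlot _ (hectorDiffeology X) m P ↔ ∀ s, IsTangentPlotAt P s := by
  refine ⟨fun hP ↦ ?_, IsTangentPlotAt.isPlot⟩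
  -- Among the axioms of a diffeology, only the one on constants is not automatic for this local
  -- property; `hconst` provides it.
  let d : DiffeologicalSpace (InternalTangentBundle X) := .ofCorePlotsOn {
    isPlotOn := fun {n u} _ p ↦ ∀ s ∈ u, IsTangentPlotAt p s
    isPlotOn_congr := fun {n u} hu p q h ↦
      ⟨fun H s hs ↦ (H s hs).congr hu hs h, fun H s hs ↦ (H s hs).congr hu hs h.symm⟩
    isPlot_const := fun {n} w s _ ↦ hconst n w s
    isPlotOn_reparam := fun {n k u v hu} hv {p f} h hp hf s hs ↦
      IsTangentPlotAt.comp hv hf hs (hp (f s) (h hs))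
    locality := fun {n u} hu {p} H s hs ↦ by
      obtain ⟨v, _, hsv, Hv⟩ := H s hs
      exact Hv s hsv }
  have hle : hectorDiffeology X ≤ d := by
    refine DiffeologicalSpace.generateFrom_le_iff.2 ?_
    rintro k p ⟨k', n, U, hU, hc, r, hr, a, v, ha, hv, hp⟩ s -
    obtain ⟨rfl, hp⟩ := Sigma.mk.inj hp
    cases hp
    exact ⟨Set.univ, isOpen_univ, trivial, n, U, hU, hc, r, hr, fun s ↦ a s, v, ha.contDiffOn,
      hv.contDiffOn, fun s _ ↦ ⟨(a s).2, rfl⟩⟩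
  exact fun s ↦ DiffeologicalSpace.le_iff'.1 hle m P hP s trivial

/-! ### Spaces with plots that lift to a diffeological group -/

/-- A smooth map `q : G → X` out of a diffeological group whose fibres are preserved by left
translations and along which plots of `X` lift locally. -/
structure IsHomogeneousProjection {G X : Type*} [Group G] [DiffeologicalSpace G]
    [DiffeologicalSpace X] (q : G → X) : Prop where
  smooth : DSmooth q
  mul_left : ∀ g h k : G, q g = q h → q (k * g) = q (k * h)
  exists_lift : ∀ {n : ℕ} {U : Set (EuclideanSpace ℝ (Fin n))}
    {r : EuclideanSpace ℝ (Fin n) → X}, IsOpen U → IsPlotOn U r → ∀ a ∈ U,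
      ∃ V : Set (EuclideanSpace ℝ (Fin n)), IsOpen V ∧ a ∈ V ∧
        ∃ g : EuclideanSpace ℝ (Fin n) → G, IsPlotOn V g ∧ ∀ y ∈ V, q (g y) = r y

/-! ### Lifting plots along quotient maps -/

section Quotient

variable {X Y : Type*} [DiffeologicalSpace X]

theorem isPlot_comp_quotientDiffeology (π : X → Y) (hπ : Function.Surjective π) {n : ℕ}
    {p : EuclideanSpace ℝ (Fin n) → X} (hp : IsPlot p) :
    @IsPlot _ (quotientDiffeology π hπ) n (π ∘ p) :=
  fun _ _ ↦ ⟨Set.univ, isOpen_univ, trivial, subset_rfl, p,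
    fun _ _ hf _ ↦ isPlot_reparam hp hf, fun _ _ ↦ rfl⟩

/-- Plots on open sets lift locally along the projection to a quotient space. -/
theorem exists_lift_quotientDiffeology (π : X → Y) (hπ : Function.Surjective π) {n : ℕ}
    {U : Set (EuclideanSpace ℝ (Fin n))} {r : EuclideanSpace ℝ (Fin n) → Y} (hU : IsOpen U)
    (hr : @IsPlotOn _ (quotientDiffeology π hπ) n U r) {a : EuclideanSpace ℝ (Fin n)}
    (ha : a ∈ U) :
    ∃ V : Set (EuclideanSpace ℝ (Fin n)), IsOpen V ∧ a ∈ V ∧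
      ∃ g : EuclideanSpace ℝ (Fin n) → X, IsPlotOn V g ∧ ∀ y ∈ V, π (g y) = r y := by
  obtain ⟨ε, hε, hεU⟩ := Metric.isOpen_iff.1 hU a ha
  -- `IsPlotOn` tests `r` only on maps from a whole `ℝⁿ`, so a ball around `a` is parametrized by
  -- `ℝⁿ`, the lift is taken there, and it is carried back by `φ.symm`.
  let φ := OpenPartialHomeomorph.univBall (E := EuclideanSpace ℝ (Fin n)) a ε
  have hφt : φ.target = Metric.ball a ε := OpenPartialHomeomorph.univBall_target a hε
  have hφ : ∀ s, φ s ∈ U := fun s ↦ by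
    refine hεU (hφt ▸ φ.map_source ?_)
    rw [OpenPartialHomeomorph.univBall_source]
    trivial
  obtain ⟨v, hv, h0v, -, g, hg, hgr⟩ :=
    hr n φ OpenPartialHomeomorph.contDiff_univBall hφ 0 trivial
  have hsymm : ContDiffOn ℝ ∞ φ.symm (Metric.ball a ε) :=
    OpenPartialHomeomorph.contDiffOn_univBall_symm
  refine ⟨Metric.ball a ε ∩ φ.symm ⁻¹' v,
    hsymm.continuousOn.isOpen_inter_preimage Metric.isOpen_ball hv,
    ⟨Metric.mem_ball_self hε, ?_⟩, g ∘ φ.symm,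
    hg.reparam (hsymm.mono Set.inter_subset_left) fun y hy ↦ hy.2, fun y hy ↦ ?_⟩
  · rw [Set.mem_preimage, OpenPartialHomeomorph.univBall_symm_apply_center]
    exact h0v
  · refine (hgr _ hy.2).trans ?_
    exact congrArg r (φ.right_inv (hφt ▸ hy.1))

end Quotient

/-- `G ⧸ H` consists of left cosets, so left translations descend to it for every subgroup `H`. -/
theorem isHomogeneousProjection_of_equiv {G : Type*} [Group G] [DiffeologicalSpace G]
    (H : Subgroup G) {X : Type*} [DiffeologicalSpace X]
    (e : X ≃ G ⧸ H) (he : DSmooth e) (he_symm : DSmooth e.symm) :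
    IsHomogeneousProjection fun g : G ↦ e.symm (QuotientGroup.mk g) where
  smooth n p hp := he_symm n _
    (isPlot_comp_quotientDiffeology QuotientGroup.mk QuotientGroup.mk_surjective hp)
  mul_left g h k hgh := by
    have hgh' := QuotientGroup.eq.1 (e.symm.injective hgh)
    refine congrArg e.symm (QuotientGroup.eq.2 ?_)
    simpa [mul_assoc] using hgh'
  exists_lift {n U r} hU hr a ha := by
    obtain ⟨V, hV, haV, g, hg, hgr⟩ := exists_lift_quotientDiffeology
      (QuotientGroup.mk : G → G ⧸ H) QuotientGroup.mk_surjective (r := e ∘ r) hU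
      (fun m f hf hfU ↦ he m _ (hr m f hf hfU)) ha
    exact ⟨V, hV, haV, g, hg, fun y hy ↦ by simp [hgr y hy]⟩

section Group

variable {G : Type*} [Group G] [DiffeologicalSpace G] [IsDiffeologicalGroup G] {n : ℕ}

theorem Diffeology.IsPlot.mul {p p' : EuclideanSpace ℝ (Fin n) → G} (hp : IsPlot p)
    (hp' : IsPlot p') : IsPlot fun t ↦ p t * p' t :=
  IsDiffeologicalGroup.smooth_mul n (fun t ↦ (p t, p' t)) ⟨hp, hp'⟩

theorem Diffeology.IsPlot.inv {p : EuclideanSpace ℝ (Fin n) → G} (hp : IsPlot p) :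
    IsPlot fun t ↦ (p t)⁻¹ :=
  IsDiffeologicalGroup.smooth_inv n p hp

end Group

theorem sigma_mk_add_eq {X : Type*} {E : X → Type*} [∀ x, Add (E x)] {x y : X} {ξ η : E x}
    {ξ' η' : E y} (hξ : (⟨x, ξ⟩ : Σ x, E x) = ⟨y, ξ'⟩) (hη : (⟨x, η⟩ : Σ x, E x) = ⟨y, η'⟩) :
    (⟨x, ξ + η⟩ : Σ x, E x) = ⟨y, ξ' + η'⟩ := by
  cases hξ
  cases hη
  rfl

/-! ### Fibrewise addition on the tangent bundle -/

namespace IsHomogeneousProjection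

variable {G X : Type*} [Group G] [DiffeologicalSpace G] [IsDiffeologicalGroup G]
  [DiffeologicalSpace X] {q : G → X}

theorem isTangentPlotAt_add (hq : IsHomogeneousProjection q) {m : ℕ}
    {x : EuclideanSpace ℝ (Fin m) → X} {ξ η : ∀ s, InternalTangentSpace (x s)}
    {s₀ : EuclideanSpace ℝ (Fin m)}
    (hξ : IsTangentPlotAt (fun s ↦ (⟨x s, ξ s⟩ : InternalTangentBundle X)) s₀)
    (hη : IsTangentPlotAt (fun s ↦ (⟨x s, η s⟩ : InternalTangentBundle X)) s₀) :
    IsTangentPlotAt (fun s ↦ (⟨x s, ξ s + η s⟩ : InternalTangentBundle X)) s₀ := by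
  obtain ⟨N₁, hN₁, hs₁, n₁, U₁, hU₁, hc₁, r₁, hr₁, a₁, v₁, ha₁, hv₁, H₁⟩ := hξ
  obtain ⟨N₂, hN₂, hs₂, n₂, U₂, hU₂, hc₂, r₂, hr₂, a₂, v₂, ha₂, hv₂, H₂⟩ := hη
  obtain ⟨V₁, hV₁, haV₁, g₁, hg₁, hgr₁⟩ := hq.exists_lift hU₁ hr₁ (a₁ s₀) (H₁ s₀ hs₁).1
  obtain ⟨V₂, hV₂, haV₂, g₂, hg₂, hgr₂⟩ := hq.exists_lift hU₂ hr₂ (a₂ s₀) (H₂ s₀ hs₂).1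
  let E := EuclideanSpace ℝ (Fin m) × EuclideanSpace ℝ (Fin n₁) × EuclideanSpace ℝ (Fin n₂)
  let φ := toEuclidean (E := E)
  -- the domain and the formula of the plot that combines `r₁` and `r₂`
  let D : Set E := {z | z.1 ∈ N₁ ∩ N₂ ∧ a₁ z.1 ∈ V₁ ∧ a₁ z.1 + z.2.1 ∈ V₁ ∧ a₂ z.1 + z.2.2 ∈ V₂}
  let F : E → X := fun z ↦ q (g₁ (a₁ z.1 + z.2.1) * (g₁ (a₁ z.1))⁻¹ * g₂ (a₂ z.1 + z.2.2))
  have hD : D ∈ 𝓝 ((s₀, 0, 0) : E) := by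
    have c₁ : ContinuousAt (fun z : E ↦ a₁ z.1) (s₀, 0, 0) :=
      ContinuousAt.comp (f := Prod.fst) (ha₁.continuousOn.continuousAt (hN₁.mem_nhds hs₁))
        continuousAt_fst
    have c₂ : ContinuousAt (fun z : E ↦ a₂ z.1) (s₀, 0, 0) :=
      ContinuousAt.comp (f := Prod.fst) (ha₂.continuousOn.continuousAt (hN₂.mem_nhds hs₂))
        continuousAt_fst
    have c₁' : ContinuousAt (fun z : E ↦ a₁ z.1 + z.2.1) (s₀, 0, 0) := c₁.add (by fun_prop)
    have c₂' : ContinuousAt (fun z : E ↦ a₂ z.1 + z.2.2) (s₀, 0, 0) := c₂.add (by fun_prop)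
    have h₁ := continuousAt_fst.preimage_mem_nhds (x := ((s₀, 0, 0) : E))
      ((hN₁.inter hN₂).mem_nhds ⟨hs₁, hs₂⟩)
    have h₂ := c₁.preimage_mem_nhds (hV₁.mem_nhds haV₁)
    have h₃ := c₁'.preimage_mem_nhds (hV₁.mem_nhds (by simpa using haV₁))
    have h₄ := c₂'.preimage_mem_nhds (hV₂.mem_nhds (by simpa using haV₂))
    filter_upwards [h₁, h₂, h₃, h₄] with z z₁ z₂ z₃ z₄ using ⟨z₁, z₂, z₃, z₄⟩
  have hD' : φ.symm ⁻¹' D ∈ 𝓝 (φ (s₀, 0, 0)) :=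
    φ.symm.continuous.continuousAt.preimage_mem_nhds (by simpa using hD)
  obtain ⟨ε, hε, hW⟩ := Metric.mem_nhds_iff.1 hD'
  have hF : IsPlotOn (Metric.ball (φ (s₀, 0, 0)) ε) (F ∘ φ.symm) := by
    intro k f hf hfW
    have hz : ContDiff ℝ ∞ fun t ↦ φ.symm (f t) := φ.symm.contDiff.comp hf
    have hzD : ∀ t, φ.symm (f t) ∈ D := fun t ↦ hW (hfW t)
    have b₁ : ContDiff ℝ ∞ fun t ↦ a₁ (φ.symm (f t)).1 :=
      ha₁.comp_contDiff hz.fst fun t ↦ (hzD t).1.1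
    have b₂ : ContDiff ℝ ∞ fun t ↦ a₂ (φ.symm (f t)).1 :=
      ha₂.comp_contDiff hz.fst fun t ↦ (hzD t).1.2
    have p₁ := hg₁ k _ (b₁.add hz.snd.fst) fun t ↦ (hzD t).2.2.1
    have p₂ := hg₁ k _ b₁ fun t ↦ (hzD t).2.1
    have p₃ := hg₂ k _ (b₂.add hz.snd.snd) fun t ↦ (hzD t).2.2.2
    exact hq.smooth k _ ((p₁.mul p₂.inv).mul p₃)
  -- `L₁` and `L₂` include the `y₁` and `y₂` directions; the parameter `s` moves the base point but
  -- contributes nothing to the tangent vector.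
  let L₁ : EuclideanSpace ℝ (Fin n₁) →L[ℝ] EuclideanSpace ℝ (Fin (Module.finrank ℝ E)) :=
    (φ : E →L[ℝ] _).comp ((ContinuousLinearMap.inr ℝ _ _).comp (ContinuousLinearMap.inl ℝ _ _))
  let L₂ : EuclideanSpace ℝ (Fin n₂) →L[ℝ] EuclideanSpace ℝ (Fin (Module.finrank ℝ E)) :=
    (φ : E →L[ℝ] _).comp ((ContinuousLinearMap.inr ℝ _ _).comp (ContinuousLinearMap.inr ℝ _ _))
  have hA : ContDiff ℝ ∞ fun s : EuclideanSpace ℝ (Fin m) ↦ φ (s, 0, 0) :=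
    φ.contDiff.comp (by fun_prop)
  refine ⟨(N₁ ∩ N₂) ∩ (fun s ↦ φ (s, 0, 0)) ⁻¹' Metric.ball (φ (s₀, 0, 0)) ε,
    (hN₁.inter hN₂).inter (Metric.isOpen_ball.preimage hA.continuous),
    ⟨⟨hs₁, hs₂⟩, Metric.mem_ball_self hε⟩, _, _, Metric.isOpen_ball, Metric.isConnected_ball hε,
    F ∘ φ.symm, hF, fun s ↦ φ (s, 0, 0), fun s ↦ L₁ (v₁ s) + L₂ (v₂ s), hA.contDiffOn, ?_, ?_⟩
  · exact (L₁.contDiff.comp_contDiffOn (hv₁.mono fun s hs ↦ hs.1.1)).add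
      (L₂.contDiff.comp_contDiffOn (hv₂.mono fun s hs ↦ hs.1.2))
  · rintro s ⟨⟨hsN₁, hsN₂⟩, hsW⟩
    refine ⟨hsW, ?_⟩
    have hsD : ((s, 0, 0) : E) ∈ D := by simpa using hW hsW
    have hsV₁ : a₁ s ∈ V₁ := hsD.2.1
    have hsV₂ : a₂ s ∈ V₂ := by simpa using hsD.2.2.2
    obtain ⟨hsU₁, e₁⟩ := H₁ s hsN₁
    obtain ⟨hsU₂, e₂⟩ := H₂ s hsN₂
    have hgg : q (g₁ (a₁ s)) = q (g₂ (a₂ s)) := by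
      rw [hgr₁ _ hsV₁, hgr₂ _ hsV₂]
      exact (congrArg Sigma.fst e₁).symm.trans (congrArg Sigma.fst e₂)
    have k₁ : ∀ᶠ y in 𝓝 0, (F ∘ φ.symm) (φ (s, 0, 0) + L₁ y) = r₁ (a₁ s + y) := by
      have : ∀ᶠ y in 𝓝 0, a₁ s + y ∈ V₁ :=
        (by fun_prop : Continuous fun y ↦ a₁ s + y).continuousAt.eventually_mem
          (hV₁.mem_nhds (by simpa using hsV₁))
      filter_upwards [this] with y hy
      have : (F ∘ φ.symm) (φ (s, 0, 0) + L₁ y) =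
          q (g₁ (a₁ s + y) * (g₁ (a₁ s))⁻¹ * g₂ (a₂ s)) := by
        have hL : φ (s, 0, 0) + L₁ y = φ (s, y, 0) :=
          (φ.map_add (s, 0, 0) (0, y, 0)).symm.trans
            (congrArg φ (Prod.ext (add_zero s) (Prod.ext (zero_add y) (add_zero 0))))
        simp [F, hL]
      -- By `hgg`, the factor `g₂ (a₂ s)` may be replaced by `g₁ (a₁ s)`, which cancels its inverse.
      rw [this, ← hq.mul_left _ _ _ hgg, inv_mul_cancel_right, hgr₁ _ hy]
    have k₂ : ∀ᶠ y in 𝓝 0, (F ∘ φ.symm) (φ (s, 0, 0) + L₂ y) = r₂ (a₂ s + y) := by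
      have : ∀ᶠ y in 𝓝 0, a₂ s + y ∈ V₂ :=
        (by fun_prop : Continuous fun y ↦ a₂ s + y).continuousAt.eventually_mem
          (hV₂.mem_nhds (by simpa using hsV₂))
      filter_upwards [this] with y hy
      have : (F ∘ φ.symm) (φ (s, 0, 0) + L₂ y) = q (g₂ (a₂ s + y)) := by
        have hL : φ (s, 0, 0) + L₂ y = φ (s, 0, y) :=
          (φ.map_add (s, 0, 0) (0, 0, y)).symm.trans
            (congrArg φ (Prod.ext (add_zero s) (Prod.ext (add_zero 0) (zero_add y))))
        simp [F, hL]
      rw [this, hgr₂ _ hy]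
    refine (sigma_mk_add_eq (e₁.trans (plotTangentMap_eq_of_eventuallyEq (hR := hF)
      (hW := Metric.isOpen_ball) (hWc := Metric.isConnected_ball hε) (A := ⟨_, hsW⟩) L₁ k₁ _))
      (e₂.trans (plotTangentMap_eq_of_eventuallyEq (hR := hF)
      (hW := Metric.isOpen_ball) (hWc := Metric.isConnected_ball hε) (A := ⟨_, hsW⟩) L₂ k₂ _))).trans
      ?_
    exact congrArg (Sigma.mk _) (CenteredPlot.push_add _ _ _).symm

/-- A tangent vector is a finite sum of vectors `p.push v`; each summand factors through its own
plot, and `isTangentPlotAt_add` merges them into one. -/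
theorem isTangentPlotAt_const (hq : IsHomogeneousProjection q) {m : ℕ}
    (w : InternalTangentBundle X) (s₀ : EuclideanSpace ℝ (Fin m)) :
    IsTangentPlotAt (fun _ ↦ w) s₀ := by
  classical
  obtain ⟨x, ξ⟩ := w
  obtain ⟨d, rfl⟩ := (tangentRelations x).mkQ_surjective ξ
  induction d using DirectSum.induction_on with
  | zero => exact IsTangentPlotAt.zero isPlot_const
  | of p v =>
    exact IsTangentPlotAt.mk_push p v
  | add d d' hd hd' =>
    rw [map_add]
    exact hq.isTangentPlotAt_add hd hd'

theorem isDVSOver_hectorDiffeology (hq : IsHomogeneousProjection q) :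
    IsDVSOver (fun x : X ↦ InternalTangentSpace x) (hectorDiffeology X) := by
  have hiff {m : ℕ} {P : EuclideanSpace ℝ (Fin m) → InternalTangentBundle X} :=
    isPlot_hectorDiffeology_iff (fun _ ↦ hq.isTangentPlotAt_const) (P := P)
  refine ⟨fun n p hp ↦ ?_, fun n p hp ↦ ?_, fun n p hp ↦ ?_, fun n p hp ↦ ?_⟩
  -- The projection is smooth for the dvs diffeology, hence for the smaller one of Hector.
  · have := (isLeast_dvsDiffeology X).1
    exact this.2.smooth_proj n p (DiffeologicalSpace.le_iff'.1 this.1 n p hp)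
  · exact hiff.2 fun s ↦ hq.isTangentPlotAt_add (hiff.1 hp.1 s) (hiff.1 hp.2 s)
  · exact hiff.2 fun s ↦ (hiff.1 hp.2 s).smul (isPlot_iff_contDiff.1 hp.1)
  · exact hiff.2 fun s ↦ IsTangentPlotAt.zero hp

end IsHomogeneousProjection

end

/-- For every homogeneous space `X`, i.e. every diffeological space diffeomorphic to `G ⧸ H` for a
diffeological group `G` and an arbitrary subgroup `H`, one has `T^H X = T^{dvs} X`. -/
theorem proposition4p11 {G : Type*} [Group G] [DiffeologicalSpace G] [IsDiffeologicalGroup G]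
    (H : Subgroup G) {X : Type*} [DiffeologicalSpace X]
    (e : X ≃ G ⧸ H) (he : DSmooth e) (he_symm : DSmooth e.symm) :
    hectorDiffeology X = dvsDiffeology X :=
  le_antisymm (isLeast_dvsDiffeology X).1.1 ((isLeast_dvsDiffeology X).2
    ⟨le_rfl, (isHomogeneousProjection_of_equiv H e he he_symm).isDVSOver_hectorDiffeology⟩)
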